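/- Let $(\Omega,\mathcal F,P)$ be a probability space, and let $\Lambda$ be the complete lattice, ordered by inclusion, of all sub-$\sigma$-fields of $\mathcal F$ that contain all $P$-null sets of $\mathcal F$. Thus $\mathcal E_1\wedge\mathcal E_2=\mathcal E_1\cap\mathcal E_2$, while $\mathcal E_1\vee\mathcal E_2$ is the least $\sigma$-field containing both. The least element of $\Lambda$ is the trivial $\sigma$-field $\mathcal O$, consisting of the null sets and their complements, and the greatest element is $\mathcal F$. A *noise-type Boolean algebra* is a sublattice $B\subset\Lambda$ containing $\mathcal O$ and $\mathcal F$ such that $B$ is a Boolean algebra (a distributive lattice in which every $x\in B$ has a complement $x'\in B$, i.e. $x\wedge x'=\mathcal O$ and $x\vee x'=\mathcal F$) and any $x,y\in B$ with $x\wedge y=\mathcal O$ are independent, i.e. $P(X\cap Y)=P(X)P(Y)$ for all $X\in x$, $Y\in y$. A subset $Z\subset\Lambda$ is *monotonically closed* if $\bigcap_n\mathcal E_n\in Z$ for every decreasing sequence $(\mathcal E_n)_n$ of elements of $Z$, and $\bigvee_n\mathcal E_n\in Z$ (the least $\sigma$-field containing all $\mathcal E_n$) for every increasing sequence $(\mathcal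 E_n)_n$ of elements of $Z$. For $B_1\subset B_2\subset\Lambda$, $B_1$ is *monotonically dense* in $B_2$ if every monotonically closed subset of $\Lambda$ that contains $B_1$ contains $B_2$. The *noise-type completion* of a noise-type Boolean algebra $B$ is the greatest, with respect to inclusion, among all noise-type Boolean algebras $C\subset\Lambda$ such that $B\subset C$ and $B$ is monotonically dense in $C$. **Theorem 1.** Every noise-type Boolean algebra $B\subset\Lambda$ has a noise-type completion; that is, among the noise-type Boolean algebras $C\supset B$ in which $B$ is monotonically dense there is a greatest one. -/

import Mathlib

open MeasureTheory ProbabilityTheory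

/-- The set `Λ` of all sub-σ-fields of the σ-field `m₀` of `(Ω, m₀, P)` that contain all null sets.
Binary and nonempty countable meets and joins of its elements, formed in the complete lattice
`MeasurableSpace Ω` (intersection; generated σ-field), are again elements of it, so they are
its own lattice operations. -/
def subSigmaFields {Ω : Type*} {m₀ : MeasurableSpace Ω} (P : Measure Ω) :
    Set (MeasurableSpace Ω) :=
  {m | m ≤ m₀ ∧ ∀ s : Set Ω, MeasurableSet[m₀] s → P s = 0 → MeasurableSet[m] s}

/-- The trivial σ-field: only the null sets and their complements. -/
def trivialSigmaField {Ω : Type*} {m₀ : MeasurableSpace Ω} (P : Measure Ω) :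
    MeasurableSpace Ω where
  MeasurableSet' s := MeasurableSet[m₀] s ∧ (P s = 0 ∨ P sᶜ = 0)
  measurableSet_empty := ⟨MeasurableSet.empty, Or.inl measure_empty⟩
  measurableSet_compl s hs := ⟨hs.1.compl, by rw [compl_compl]; exact hs.2.symm⟩
  measurableSet_iUnion f hf := by
    refine ⟨MeasurableSet.iUnion fun i => (hf i).1, ?_⟩
    by_cases h : ∀ i, P (f i) = 0
    · exact Or.inl (measure_iUnion_null h)
    · obtain ⟨i, hi⟩ := not_forall.1 h
      exact Or.inr (measure_mono_null (Set.compl_subset_compl.2 (Set.subset_iUnion f i))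
        ((hf i).2.resolve_left hi))

/-- A noise-type Boolean algebra: a sublattice `B` of `Λ` that contains the trivial σ-field and
the whole σ-field, is a Boolean algebra (a distributive, complemented lattice), and in which
any two σ-fields with trivial intersection are independent. -/
structure IsNoiseTypeBooleanAlgebra {Ω : Type*} {m₀ : MeasurableSpace Ω} (P : Measure Ω)
    (B : Set (MeasurableSpace Ω)) : Prop where
  subset : B ⊆ subSigmaFields P
  inf_mem : ∀ x ∈ B, ∀ y ∈ B, x ⊓ y ∈ B
  sup_mem : ∀ x ∈ B, ∀ y ∈ B, x ⊔ y ∈ B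
  trivial_mem : trivialSigmaField P ∈ B
  whole_mem : m₀ ∈ B
  distrib : ∀ x ∈ B, ∀ y ∈ B, ∀ z ∈ B, x ⊓ (y ⊔ z) = (x ⊓ y) ⊔ (x ⊓ z)
  exists_compl : ∀ x ∈ B, ∃ y ∈ B, x ⊓ y = trivialSigmaField P ∧ x ⊔ y = m₀
  indep : ∀ x ∈ B, ∀ y ∈ B, x ⊓ y = trivialSigmaField P → Indep x y P

/-- A set of σ-fields is monotonically closed if it contains the intersection of every decreasing
sequence of its elements and the σ-field generated by every increasing sequence of
its elements. -/
def MonotonicallyClosed {Ω : Type*} (Z : Set (MeasurableSpace Ω)) : Prop :=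
  (∀ x : ℕ → MeasurableSpace Ω, (∀ n, x n ∈ Z) → Antitone x → (⨅ n, x n) ∈ Z) ∧
  (∀ x : ℕ → MeasurableSpace Ω, (∀ n, x n ∈ Z) → Monotone x → (⨆ n, x n) ∈ Z)

/-- `B₁` is monotonically dense in `B₂`: every monotonically closed subset of `Λ` that
contains `B₁` contains `B₂`. -/
def MonotonicallyDense {Ω : Type*} {m₀ : MeasurableSpace Ω} (P : Measure Ω)
    (B₁ B₂ : Set (MeasurableSpace Ω)) : Prop :=
  ∀ Z : Set (MeasurableSpace Ω), Z ⊆ subSigmaFields P → MonotonicallyClosed Z → B₁ ⊆ Z → B₂ ⊆ Z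

/-- `C` is the noise-type completion of `B`: the greatest (for inclusion) among all noise-type
Boolean algebras that contain `B` and in which `B` is monotonically dense. -/
def IsNoiseTypeCompletion {Ω : Type*} {m₀ : MeasurableSpace Ω} (P : Measure Ω)
    (B C : Set (MeasurableSpace Ω)) : Prop :=
  IsGreatest {D | IsNoiseTypeBooleanAlgebra P D ∧ B ⊆ D ∧ MonotonicallyDense P B D} C

/-! ### Orthogonal projections: monotone limits and commutation. -/

section HilbertSpace

variable {H : Type*} [NormedAddCommGroup H] [InnerProductSpace ℝ H]

/-! The completion is explicit: let `monotoneClosure P B` be the least monotonically closed set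
containing `B`, and keep those of its elements that have a complement in it. Any competitor lies in
the closure by density and contains the complements of its own elements, so maximality is immediate;
the work is to show that this set is a noise-type Boolean algebra.

Each σ-field is encoded by its conditional expectation on `L²`. Distributivity and independence make
these projections commute on `B`, and commutation survives monotone limits because the projections
converge strongly. Hence on the whole closure the product of two projections is the projection of
the meet, which yields stability under meets, continuity of meets along increasing sequences
(`iSup_inf_of_commute`), and independence of elements with trivial meet (`indep_of_commute`).

Joins are harder, since joins and decreasing limits need not interchange. They do under independence
(`iInf_sup_of_indep`), and a complement `z` of `y` provides it: `x ⊔ y = (x ⊓ z) ⊔ y` with `x ⊓ z`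
independent of `y`. This rests on the splitting `x = (x ⊓ y) ⊔ (x ⊓ z)` (`eq_sup`), which also gives
distributivity. -/

/-- The orthogonal complements increase, and the closure of their union is `Vᗮ`; subtract their
projections from the identity. -/
theorem tendsto_starProjection_iInf [CompleteSpace H] (U : ℕ → Submodule ℝ H) [∀ n, (U n).HasOrthogonalProjection]
    (V : Submodule ℝ H) [V.HasOrthogonalProjection] (hU : Antitone U) (hV : V = ⨅ n, U n) (f : H) :
    Filter.Tendsto (fun n => (U n).starProjection f) Filter.atTop (nhds (V.starProjection f)) := by
  have h1 := Submodule.starProjection_tendsto_closure_iSup (fun n => (U n)ᗮ)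
    (fun i j hij => Submodule.orthogonal_le (hU hij)) f
  have h2 : (⨆ n, (U n)ᗮ).topologicalClosure = Vᗮ := by
    rw [← Submodule.orthogonal_orthogonal_eq_closure, ← Submodule.iInf_orthogonal, hV]
    simp only [Submodule.orthogonal_orthogonal]
  simp only [h2, Submodule.starProjection_orthogonal] at h1
  have h3 := (tendsto_const_nhds (x := f)).sub h1
  simpa using h3

theorem Submodule.starProjection_inf_of_commute (K L : Submodule ℝ H) [K.HasOrthogonalProjection]
    [L.HasOrthogonalProjection] [(K ⊓ L).HasOrthogonalProjection]
    (h : Commute K.starProjection L.starProjection) (f : H) :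
    (K ⊓ L).starProjection f = K.starProjection (L.starProjection f) := by
  refine Submodule.eq_starProjection_of_mem_of_inner_eq_zero ⟨?_, ?_⟩ ?_
  · exact Submodule.starProjection_apply_mem _ _
  · have := DFunLike.congr_fun h.eq f
    simp only [mul_apply_eq_comp] at this
    rw [this]
    exact Submodule.starProjection_apply_mem _ _
  · rintro w ⟨hK, hL⟩
    have h1 := Submodule.starProjection_inner_eq_zero (K := L) f w hL
    have h2 := Submodule.starProjection_inner_eq_zero (K := K) (L.starProjection f) w hK
    rw [inner_sub_left] at *
    linarith

/-- By self-adjointness, a projection that preserves `L` also preserves `Lᗮ`. -/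
theorem Submodule.commute_starProjection_of_mapsTo (K L : Submodule ℝ H)
    [K.HasOrthogonalProjection] [L.HasOrthogonalProjection]
    (h : ∀ f ∈ L, K.starProjection f ∈ L) : Commute K.starProjection L.starProjection := by
  refine ContinuousLinearMap.ext fun f => ?_
  simp only [mul_apply_eq_comp]
  refine Submodule.eq_starProjection_of_mem_of_inner_eq_zero
    (h _ (Submodule.starProjection_apply_mem _ _)) ?_ |>.symm
  intro w hw
  rw [← map_sub, K.inner_starProjection_left_eq_right]
  exact Submodule.starProjection_inner_eq_zero (K := L) f _ (h w hw)

end HilbertSpace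

/-! ### The dictionary between σ-fields and closed subspaces of `L²`. -/

section SubspaceOfSigmaField

variable {Ω : Type*} {x y : MeasurableSpace Ω} {m₀ : MeasurableSpace Ω} {P : Measure Ω}

/-- The closed subspace of square integrable functions measurable with respect to `x`. -/
noncomputable def measL2 (P : Measure Ω) (x : MeasurableSpace Ω) : Submodule ℝ (Lp ℝ 2 P) :=
  (@lpMeas Ω ℝ ℝ _ _ _ x m₀ 2 P).topologicalClosure

instance hasOrthogonalProjection_measL2 (P : Measure Ω) (x : MeasurableSpace Ω) :
    (measL2 P x).HasOrthogonalProjection := by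
  unfold measL2; infer_instance

/-- Conditional expectation on `L²`. -/
noncomputable def condProj (P : Measure Ω) (x : MeasurableSpace Ω) : Lp ℝ 2 P →L[ℝ] Lp ℝ 2 P :=
  (measL2 P x).starProjection

theorem isClosed_measL2 : IsClosed (measL2 P x : Set (Lp ℝ 2 P)) :=
  Submodule.isClosed_topologicalClosure _

/-- The closure in `measL2` gives a projection for every `x` without hypotheses; below `m₀` it adds
nothing. -/
theorem measL2_eq_lpMeas (hx : x ≤ m₀) : measL2 P x = lpMeas ℝ ℝ x 2 P :=
  IsClosed.submodule_topologicalClosure_eq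
    (isClosed_aestronglyMeasurable (F := ℝ) (p := 2) (μ := P) hx)

theorem mem_measL2 (hx : x ≤ m₀) {f : Lp ℝ 2 P} :
    f ∈ measL2 P x ↔ AEStronglyMeasurable[x] f P := by
  rw [measL2_eq_lpMeas hx, mem_lpMeas_iff_aestronglyMeasurable]

theorem condProj_mem (f : Lp ℝ 2 P) : condProj P x f ∈ measL2 P x :=
  Submodule.starProjection_apply_mem _ _

theorem condProj_of_mem {f : Lp ℝ 2 P} (hf : f ∈ measL2 P x) : condProj P x f = f :=
  Submodule.starProjection_eq_self_iff.2 hf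

theorem measL2_mono (hy : y ≤ m₀) (h : x ≤ y) : measL2 P x ≤ measL2 P y := by
  intro f hf
  rw [mem_measL2 (h.trans hy)] at hf
  rw [mem_measL2 hy]
  exact hf.mono h

/-- Preimages under `f` and `g` differ by null sets, all of which belong to `x`. This turns
almost-everywhere statements into exact ones. -/
theorem measurable_of_aestronglyMeasurable (hx : x ∈ subSigmaFields P) {f g : Ω → ℝ}
    (hf : Measurable[m₀] f) (hg : Measurable[x] g) (hfg : f =ᵐ[P] g) : Measurable[x] f := by
  intro s hs
  have hf' := hf hs
  have hg' := hg hs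
  have h0 : ∀ t : Set Ω, MeasurableSet[m₀] t → t ⊆ {ω | f ω ≠ g ω} → MeasurableSet[x] t :=
    fun t ht hts => hx.2 t ht (measure_mono_null hts hfg)
  have hgm := hx.1 _ hg'
  have e : f ⁻¹' s = ((g ⁻¹' s) \ (g ⁻¹' s \ f ⁻¹' s)) ∪ (f ⁻¹' s \ g ⁻¹' s) := by
    ext ω; simp only [Set.mem_union, Set.mem_sdiff]; tauto
  rw [e]
  refine MeasurableSet.union (MeasurableSet.diff hg' (h0 _ (hgm.diff hf') ?_))
    (h0 _ (hf'.diff hgm) ?_)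
  · rintro ω ⟨h1, h2⟩ h3
    exact h2 (by rw [Set.mem_preimage, h3]; exact h1)
  · rintro ω ⟨h1, h2⟩ h3
    exact h2 (by rw [Set.mem_preimage, ← h3]; exact h1)

theorem measL2_iInf {ι : Type*} [Nonempty ι] (u : ι → MeasurableSpace Ω)
    (hu : ∀ i, u i ∈ subSigmaFields P) : measL2 P (⨅ i, u i) = ⨅ i, measL2 P (u i) := by
  obtain ⟨i₀⟩ := ‹Nonempty ι›
  have hle : ⨅ i, u i ≤ m₀ := (iInf_le u i₀).trans (hu i₀).1
  refine le_antisymm (le_iInf fun i => measL2_mono (hu i).1 (iInf_le u i)) fun f hf => ?_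
  rw [Submodule.mem_iInf] at hf
  rw [mem_measL2 hle]
  have h := fun i => (mem_measL2 (hu i).1).1 (hf i)
  obtain ⟨g, hg, hfg⟩ := h i₀
  -- A representative measurable for one index is measurable for every index, because null sets lie
  -- in each `u i`.
  refine ⟨g, Measurable.stronglyMeasurable fun s hs => ?_, hfg⟩
  rw [MeasurableSpace.measurableSet_iInf]
  intro i
  obtain ⟨k, hk, hfk⟩ := h i
  exact measurable_of_aestronglyMeasurable (hu i) (hg.measurable.mono (hu i₀).1 le_rfl)
    hk.measurable (hfg.symm.trans hfk) hs

theorem measL2_inf (hx : x ∈ subSigmaFields P) (hy : y ∈ subSigmaFields P) :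
    measL2 P (x ⊓ y) = measL2 P x ⊓ measL2 P y := by
  rw [inf_eq_iInf, measL2_iInf _ (by simp [hx, hy]), inf_eq_iInf]
  congr 1
  ext b
  cases b <;> rfl

theorem tendsto_condProj_iInf {u : ℕ → MeasurableSpace Ω} (hu : ∀ n, u n ∈ subSigmaFields P)
    (hanti : Antitone u) (f : Lp ℝ 2 P) : Filter.Tendsto (fun n => condProj P (u n) f)
      Filter.atTop (nhds (condProj P (⨅ n, u n) f)) :=
  tendsto_starProjection_iInf (fun n => measL2 P (u n)) (measL2 P (⨅ n, u n))
    (fun i _ hij => measL2_mono (hu i).1 (hanti hij)) (measL2_iInf u hu) f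

/-- A set is recovered from its indicator as the preimage of `1`. Inclusions of σ-fields can thus be
proved in `L²`. -/
theorem le_of_measL2_le [IsFiniteMeasure P] (hx : x ≤ m₀) (hy : y ∈ subSigmaFields P)
    (h : measL2 P x ≤ measL2 P y) : x ≤ y := by
  intro s hs
  have h1 : indicatorConstLp 2 (hx s hs) (measure_ne_top P s) (1 : ℝ) ∈ measL2 P x := by
    rw [measL2_eq_lpMeas hx]
    exact mem_lpMeas_indicatorConstLp (𝕜 := ℝ) (F := ℝ) hx hs (measure_ne_top P s)
  obtain ⟨g, hg, hfg⟩ := (mem_measL2 hy.1).1 (h h1)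
  have h2 : s.indicator (fun _ => (1 : ℝ)) =ᵐ[P] g := indicatorConstLp_coeFn.symm.trans hfg
  have h3 := measurable_of_aestronglyMeasurable hy
    (measurable_const.indicator (hx s hs)) hg.measurable h2 (measurableSet_singleton (1 : ℝ))
  convert! h3
  ext ω
  by_cases hω : ω ∈ s <;> simp [hω]

/-- The indicator of a set, as an element of `L²`; zero if the set is not measurable. -/
noncomputable def indL2 (P : Measure Ω) [IsFiniteMeasure P] (s : Set Ω) : Lp ℝ 2 P :=
  open Classical in
  if hs : MeasurableSet[m₀] s then indicatorConstLp 2 hs (measure_ne_top P s) (1 : ℝ) else 0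

variable [IsFiniteMeasure P]

theorem indL2_eq {s : Set Ω} (hs : MeasurableSet[m₀] s) :
    indL2 P s = indicatorConstLp 2 hs (measure_ne_top P s) (1 : ℝ) := by
  rw [indL2, dif_pos hs]

theorem indL2_ae {s : Set Ω} (hs : MeasurableSet[m₀] s) :
    indL2 P s =ᵐ[P] s.indicator fun _ => (1 : ℝ) := by
  rw [indL2_eq hs]; exact indicatorConstLp_coeFn

theorem indL2_mem (hx : x ≤ m₀) {s : Set Ω} (hs : MeasurableSet[x] s) : indL2 P s ∈ measL2 P x := by
  rw [indL2_eq (hx s hs), measL2_eq_lpMeas hx]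
  exact mem_lpMeas_indicatorConstLp (𝕜 := ℝ) (F := ℝ) hx hs (measure_ne_top P s)

theorem inner_indL2 {s t : Set Ω} (hs : MeasurableSet[m₀] s) (ht : MeasurableSet[m₀] t) :
    inner ℝ (indL2 P s) (indL2 P t) = P.real (s ∩ t) := by
  rw [indL2_eq hs, indL2_eq ht, L2.real_inner_indicatorConstLp_one_indicatorConstLp_one]

theorem indL2_compl {s : Set Ω} (hs : MeasurableSet[m₀] s) :
    indL2 P sᶜ = indL2 P Set.univ - indL2 P s := by
  refine Lp.ext ?_
  filter_upwards [indL2_ae (P := P) hs, indL2_ae (P := P) hs.compl, indL2_ae (P := P) .univ,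
    Lp.coeFn_sub (indL2 P Set.univ) (indL2 P s)] with ω h1 h2 h3 h4
  rw [h4, Pi.sub_apply, h1, h2, h3]
  by_cases hω : ω ∈ s <;> simp [hω]

theorem indL2_union {s t : Set Ω} (hs : MeasurableSet[m₀] s) (ht : MeasurableSet[m₀] t)
    (hst : Disjoint s t) : indL2 P (s ∪ t) = indL2 P s + indL2 P t := by
  rw [indL2_eq (hs.union ht), indL2_eq hs, indL2_eq ht]
  exact indicatorConstLp_disjoint_union hs ht _ _ hst 1

/-- A closed subspace containing the indicators of a generating π-system contains every square
integrable function measurable with respect to the generated σ-field. -/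
theorem measL2_le_of_isPiSystem (hx : x ≤ m₀) {C : Set (Set Ω)}
    (hxC : x = MeasurableSpace.generateFrom C) (hC : IsPiSystem C) {N : Submodule ℝ (Lp ℝ 2 P)}
    (hN : IsClosed (N : Set (Lp ℝ 2 P))) (huniv : indL2 P Set.univ ∈ N)
    (h : ∀ s ∈ C, indL2 P s ∈ N) : measL2 P x ≤ N := by
  have hind : ∀ s, MeasurableSet[x] s → indL2 P s ∈ N := by
    intro s hs
    induction s, hs using MeasurableSpace.induction_on_inter hxC hC with
    | empty =>
      have := indL2_compl (P := P) MeasurableSet.univ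
      rw [Set.compl_univ, sub_self] at this
      rw [this]; exact N.zero_mem
    | basic s hs => exact h s hs
    | compl s hs ih => rw [indL2_compl (hx s hs)]; exact N.sub_mem huniv ih
    | iUnion f hd hf ih =>
      have hp : ∀ n, indL2 P (⋃ i ∈ Finset.range n, f i) ∈ N := by
        intro n
        induction n with
        | zero =>
          have := indL2_compl (P := P) MeasurableSet.univ
          rw [Set.compl_univ, sub_self] at this
          simp [this]
        | succ n ihn =>
          have e : (⋃ i ∈ Finset.range (n + 1), f i) = (⋃ i ∈ Finset.range n, f i) ∪ f n := by
            rw [Finset.range_add_one, Finset.set_biUnion_insert, Set.union_comm]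
          rw [e, indL2_union (Finset.measurableSet_biUnion _ fun i _ => hx _ (hf i)) (hx _ (hf n))]
          · exact N.add_mem ihn (ih n)
          · simp only [Set.disjoint_iUnion_left]
            intro i hi
            exact hd (Finset.mem_range.1 hi).ne
      -- The indicators of the finite partial unions converge in `L²`, since the measure of the
      -- remaining tail tends to zero.
      refine hN.mem_of_tendsto (b := Filter.atTop) ?_ (Filter.Eventually.of_forall hp)
      have hm : ∀ n, MeasurableSet[m₀] (⋃ i ∈ Finset.range n, f i) :=
        fun n => Finset.measurableSet_biUnion _ fun i _ => hx _ (hf i)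
      have hU : MeasurableSet[m₀] (⋃ i, f i) := MeasurableSet.iUnion fun i => hx _ (hf i)
      rw [indL2_eq hU]
      simp_rw [fun n => indL2_eq (P := P) (hm n)]
      refine tendsto_indicatorConstLp_set (by norm_num) ?_
      have h1 : Filter.Tendsto (fun n => P ((⋃ i, f i) \ ⋃ i ∈ Finset.range n, f i)) Filter.atTop
          (nhds (P (⋂ n, ((⋃ i, f i) \ ⋃ i ∈ Finset.range n, f i)))) := by
        refine tendsto_measure_iInter_atTop (fun n => (hU.diff (hm n)).nullMeasurableSet) ?_
          ⟨0, measure_ne_top _ _⟩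
        intro a b hab
        refine Set.sdiff_subset_sdiff_right (Set.biUnion_subset_biUnion_left ?_)
        intro i hi
        exact Finset.mem_coe.2 (Finset.range_mono hab hi)
      have h2 : (⋂ n, ((⋃ i, f i) \ ⋃ i ∈ Finset.range n, f i)) = ∅ := by
        ext ω
        simp only [Set.mem_iInter, Set.mem_sdiff, Set.mem_iUnion, Set.mem_empty_iff_false, iff_false,
          not_forall]
        by_cases hω : ∃ i, ω ∈ f i
        · obtain ⟨i, hi⟩ := hω
          exact ⟨i + 1, fun h => h.2 ⟨i, by simp, hi⟩⟩
        · exact ⟨0, fun h => hω h.1⟩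
      rw [h2, measure_empty] at h1
      refine h1.congr fun n => ?_
      rw [symmDiff_of_le]
      exact Set.iUnion₂_subset fun i _ => Set.subset_iUnion f i
  intro f hf
  rw [mem_measL2 hx] at hf
  refine Lp.induction_stronglyMeasurable hx ENNReal.ofNat_ne_top (fun f => f ∈ N) ?_ ?_ ?_ f hf
  · intro c s hs hμ
    have e : (Lp.simpleFunc.indicatorConst 2 (hx s hs) hμ.ne c : Lp ℝ 2 P) = c • indL2 P s := by
      rw [indL2_eq (hx s hs), Lp.simpleFunc.coe_indicatorConst]
      refine Lp.ext ?_
      filter_upwards [Lp.coeFn_smul c (indicatorConstLp 2 (hx s hs) (measure_ne_top P s) (1 : ℝ)),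
        indicatorConstLp_coeFn (p := 2) (hs := hx s hs) (hμs := measure_ne_top P s) (c := (1 : ℝ)),
        indicatorConstLp_coeFn (p := 2) (hs := hx s hs) (hμs := hμ.ne) (c := c)] with ω h1 h2 h3
      rw [h1, h3, Pi.smul_apply, h2]
      by_cases hω : ω ∈ s <;> simp [hω]
    change (Lp.simpleFunc.indicatorConst 2 (hx s hs) hμ.ne c : Lp ℝ 2 P) ∈ N
    rw [e]
    exact N.smul_mem c (hind s hs)
  · intro f g hf hg _ _ _ h1 h2
    exact N.add_mem h1 h2
  · exact hN.preimage continuous_subtype_val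

theorem measL2_le_of_forall_measurableSet (hx : x ≤ m₀) {N : Submodule ℝ (Lp ℝ 2 P)}
    (hN : IsClosed (N : Set (Lp ℝ 2 P))) (h : ∀ s, MeasurableSet[x] s → indL2 P s ∈ N) :
    measL2 P x ≤ N :=
  measL2_le_of_isPiSystem hx (@MeasurableSpace.generateFrom_measurableSet Ω x).symm
    (@MeasurableSpace.isPiSystem_measurableSet Ω x) hN (h _ MeasurableSet.univ) h

theorem measL2_sup_le {a b : MeasurableSpace Ω} (ha : a ≤ m₀) (hb : b ≤ m₀)
    {N : Submodule ℝ (Lp ℝ 2 P)} (hN : IsClosed (N : Set (Lp ℝ 2 P)))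
    (h : ∀ s t, MeasurableSet[a] s → MeasurableSet[b] t → indL2 P (s ∩ t) ∈ N) :
    measL2 P (a ⊔ b) ≤ N := by
  refine measL2_le_of_isPiSystem (sup_le ha hb)
    (C := {w | ∃ s t, MeasurableSet[a] s ∧ MeasurableSet[b] t ∧ s ∩ t = w}) ?_ ?_ hN ?_ ?_
  · refine le_antisymm (sup_le ?_ ?_) (MeasurableSpace.generateFrom_le ?_)
    · exact fun s hs => MeasurableSpace.measurableSet_generateFrom
        ⟨s, Set.univ, hs, MeasurableSet.univ, Set.inter_univ s⟩
    · exact fun s hs => MeasurableSpace.measurableSet_generateFrom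
        ⟨Set.univ, s, MeasurableSet.univ, hs, Set.univ_inter s⟩
    · rintro w ⟨s, t, hs, ht, rfl⟩
      exact MeasurableSet.inter ((le_sup_left : a ≤ a ⊔ b) s hs) ((le_sup_right : b ≤ a ⊔ b) t ht)
  · rintro _ ⟨s, t, hs, ht, rfl⟩ _ ⟨s', t', hs', ht', rfl⟩ _
    exact ⟨s ∩ s', t ∩ t', hs.inter hs', ht.inter ht', Set.inter_inter_inter_comm ..⟩
  · simpa using h Set.univ Set.univ MeasurableSet.univ MeasurableSet.univ
  · rintro _ ⟨s, t, hs, ht, rfl⟩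
    exact h s t hs ht

/-- The union of an increasing sequence of σ-fields is a π-system generating their join. -/
theorem measL2_iSup (u : ℕ → MeasurableSpace Ω) (hu : ∀ n, u n ≤ m₀) (hmono : Monotone u) :
    measL2 P (⨆ n, u n) = (⨆ n, measL2 P (u n)).topologicalClosure := by
  have hle : ⨆ n, u n ≤ m₀ := iSup_le hu
  refine le_antisymm ?_ (Submodule.topologicalClosure_minimal _
    (iSup_le fun n => measL2_mono hle (le_iSup u n)) isClosed_measL2)
  have hN : ∀ n, ∀ s, MeasurableSet[u n] s →
      indL2 P s ∈ (⨆ n, measL2 P (u n)).topologicalClosure := fun n s hs =>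
    Submodule.le_topologicalClosure _ (Submodule.mem_iSup_of_mem n (indL2_mem (hu n) hs))
  refine measL2_le_of_isPiSystem hle (C := {s | ∃ n, MeasurableSet[u n] s}) ?_ ?_
    (Submodule.isClosed_topologicalClosure _) (hN 0 _ MeasurableSet.univ) ?_
  · exact MeasurableSpace.measurableSpace_iSup_eq u
  · rintro s ⟨n, hs⟩ t ⟨k, ht⟩ _
    exact ⟨max n k, (hmono (le_max_left n k) _ hs).inter (hmono (le_max_right n k) _ ht)⟩
  · rintro s ⟨n, hs⟩
    exact hN n s hs

theorem tendsto_condProj_iSup {u : ℕ → MeasurableSpace Ω} (hu : ∀ n, u n ∈ subSigmaFields P)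
    (hmono : Monotone u) (f : Lp ℝ 2 P) : Filter.Tendsto (fun n => condProj P (u n) f)
      Filter.atTop (nhds (condProj P (⨆ n, u n) f)) := by
  have h := measL2_iSup (P := P) u (fun n => (hu n).1) hmono
  have : (⨆ n, measL2 P (u n)).topologicalClosure.HasOrthogonalProjection := by
    rw [← h]; infer_instance
  have h1 := Submodule.starProjection_tendsto_closure_iSup (fun n => measL2 P (u n))
    (fun _ j hij => measL2_mono (hu j).1 (hmono hij)) f
  simp only [← h] at h1
  exact h1

end SubspaceOfSigmaField

/-! ### Consequences of commuting conditional expectations. -/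

section Commuting

variable {Ω : Type*} {x y z : MeasurableSpace Ω} {m₀ : MeasurableSpace Ω} {P : Measure Ω}

theorem inf_mem_subSigmaFields (hx : x ∈ subSigmaFields P) (hy : y ∈ subSigmaFields P) :
    x ⊓ y ∈ subSigmaFields P :=
  ⟨inf_le_left.trans hx.1, fun s hs h0 =>
    MeasurableSpace.measurableSet_inf.2 ⟨hx.2 s hs h0, hy.2 s hs h0⟩⟩

theorem mem_subSigmaFields_of_le (hx : x ∈ subSigmaFields P) (hy : y ≤ m₀) (h : x ≤ y) :
    y ∈ subSigmaFields P :=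
  ⟨hy, fun s hs h0 => h s (hx.2 s hs h0)⟩

theorem sup_mem_subSigmaFields (hx : x ∈ subSigmaFields P) (hy : y ∈ subSigmaFields P) :
    x ⊔ y ∈ subSigmaFields P :=
  mem_subSigmaFields_of_le hx (sup_le hx.1 hy.1) le_sup_left

theorem iInf_mem_subSigmaFields {u : ℕ → MeasurableSpace Ω} (hu : ∀ n, u n ∈ subSigmaFields P) :
    (⨅ n, u n) ∈ subSigmaFields P :=
  ⟨(iInf_le u 0).trans (hu 0).1, fun s hs h0 =>
    MeasurableSpace.measurableSet_iInf.2 fun n => (hu n).2 s hs h0⟩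

theorem iSup_mem_subSigmaFields {u : ℕ → MeasurableSpace Ω} (hu : ∀ n, u n ∈ subSigmaFields P) :
    (⨆ n, u n) ∈ subSigmaFields P :=
  mem_subSigmaFields_of_le (hu 0) (iSup_le fun n => (hu n).1) (le_iSup u 0)

theorem trivialSigmaField_le (hx : x ∈ subSigmaFields P) : trivialSigmaField P ≤ x := by
  rintro s ⟨hs, h | h⟩
  · exact hx.2 s hs h
  · have := (hx.2 sᶜ hs.compl h).compl
    rwa [compl_compl] at this

theorem condProj_inf_of_commute (hx : x ∈ subSigmaFields P) (hy : y ∈ subSigmaFields P)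
    (h : Commute (condProj P x) (condProj P y)) (f : Lp ℝ 2 P) :
    condProj P (x ⊓ y) f = condProj P x (condProj P y f) := by
  have hI : (measL2 P x ⊓ measL2 P y).HasOrthogonalProjection := by
    rw [← measL2_inf hx hy]; infer_instance
  have := Submodule.starProjection_inf_of_commute _ _ h f
  simp only [← measL2_inf hx hy] at this
  exact this

theorem commute_of_tendsto {u : ℕ → MeasurableSpace Ω}
    (hlim : ∀ f, Filter.Tendsto (fun n => condProj P (u n) f) Filter.atTop
      (nhds (condProj P x f)))
    (h : ∀ n, Commute (condProj P (u n)) (condProj P y)) :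
    Commute (condProj P x) (condProj P y) := by
  refine ContinuousLinearMap.ext fun f => ?_
  simp only [mul_apply_eq_comp]
  refine tendsto_nhds_unique (hlim (condProj P y f)) ?_
  have h1 := ((condProj P y).continuous.tendsto _).comp (hlim f)
  refine h1.congr fun n => ?_
  exact (DFunLike.congr_fun (h n).eq f).symm

variable [IsFiniteMeasure P]

/-- For `f` measurable with respect to the left side, `condProj P (u n) f` tends to `f`; as `f` is
fixed by the projection of `y`, commutation makes each term measurable with respect to `u n ⊓ y`. -/
theorem iSup_inf_of_commute {u : ℕ → MeasurableSpace Ω} (hu : ∀ n, u n ∈ subSigmaFields P)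
    (hmono : Monotone u) (hy : y ∈ subSigmaFields P)
    (h : ∀ n, Commute (condProj P (u n)) (condProj P y)) :
    (⨆ n, u n) ⊓ y = ⨆ n, u n ⊓ y := by
  have hU := iSup_mem_subSigmaFields hu
  have hV := iSup_mem_subSigmaFields fun n => inf_mem_subSigmaFields (hu n) hy
  refine le_antisymm (le_of_measL2_le (inf_mem_subSigmaFields hU hy).1 hV fun f hf => ?_)
    (iSup_le fun n => inf_le_inf_right _ (le_iSup u n))
  have h1 := tendsto_condProj_iSup hu hmono f
  rw [condProj_of_mem (measL2_mono hU.1 inf_le_left hf)] at h1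
  refine isClosed_measL2.mem_of_tendsto h1 (Filter.Eventually.of_forall fun n => ?_)
  have h2 := condProj_inf_of_commute (hu n) hy (h n) f
  rw [condProj_of_mem (measL2_mono hy.1 inf_le_right hf)] at h2
  simp only [SetLike.mem_coe]
  rw [← h2]
  exact measL2_mono hV.1 (le_iSup (fun n => u n ⊓ y) n) (condProj_mem f)

theorem measL2_trivialSigmaField :
    measL2 P (trivialSigmaField P) ≤ Submodule.span ℝ {indL2 P Set.univ} := by
  have hle : trivialSigmaField P ≤ m₀ := fun s hs => hs.1
  refine measL2_le_of_forall_measurableSet hle (Submodule.closed_of_finiteDimensional _)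
    fun s hs => ?_
  obtain ⟨hs, h | h⟩ := hs
  · have : indL2 P s = 0 := by
      refine Lp.ext ?_
      filter_upwards [indL2_ae (P := P) hs, Lp.coeFn_zero ℝ 2 P, measure_eq_zero_iff_ae_notMem.1 h]
        with ω h1 h2 h3
      rw [h1, h2]
      simp [h3]
    rw [this]
    exact Submodule.zero_mem _
  · have : indL2 P s = indL2 P Set.univ := by
      refine Lp.ext ?_
      filter_upwards [indL2_ae (P := P) hs, indL2_ae (P := P) .univ,
        measure_eq_zero_iff_ae_notMem.1 h] with ω h1 h2 h3
      rw [h1, h2]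
      simp only [Set.mem_compl_iff, not_not] at h3
      simp [h3]
    rw [this]
    exact Submodule.mem_span_singleton_self _

/-- The indicator of `t` factors out of the conditional expectation on `x`, and multiplying by it
preserves `z`-measurability. -/
theorem condProj_inter_mem (hz : z ≤ m₀) (hx : x ≤ m₀) {s t : Set Ω} (hs : MeasurableSet[m₀] s)
    (htx : MeasurableSet[x] t) (htz : MeasurableSet[z] t) (h : condProj P x (indL2 P s) ∈ measL2 P z) :
    condProj P x (indL2 P (s ∩ t)) ∈ measL2 P z := by
  have key : ∀ r, MeasurableSet[m₀] r →
      condProj P x (indL2 P r) =ᵐ[P] P[r.indicator fun _ => (1 : ℝ) | x] := by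
    intro r hr
    have hm : MemLp (r.indicator fun _ => (1 : ℝ)) 2 P :=
      memLp_indicator_const 2 hr 1 (Or.inr (measure_ne_top P r))
    refine Filter.EventuallyEq.trans ?_ (hm.condExpL2_ae_eq_condExp (𝕜 := ℝ) hx)
    rw [indL2_eq hr]
    have e : (condExpL2 ℝ ℝ hx hm.toLp : Lp ℝ 2 P) =
        condProj P x (indicatorConstLp 2 hr (measure_ne_top P r) (1 : ℝ)) := by
      rw [condExpL2, condProj]
      simp only [measL2_eq_lpMeas hx]
      rfl
    rw [e]
  rw [mem_measL2 hz] at h ⊢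
  obtain ⟨g, hg, hfg⟩ := h
  refine ⟨t.indicator g, hg.indicator htz, ?_⟩
  have hint : Integrable (s.indicator fun _ => (1 : ℝ)) P := (integrable_const 1).indicator hs
  have h1 := condExp_indicator (m := x) hint htx
  rw [Set.indicator_indicator, Set.inter_comm] at h1
  filter_upwards [key _ (hs.inter (hx t htx)), h1, key s hs, hfg] with ω e1 e2 e3 e4
  rw [e1, e2]
  by_cases hω : ω ∈ t
  · simp only [Set.indicator_of_mem hω]
    rw [← e3, e4]
  · simp only [Set.indicator_of_notMem hω]

end Commuting

/-! ### Independence: its derivation from commutation, and its effect on joins. -/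

section Independence

variable {Ω : Type*} {x y z u v : MeasurableSpace Ω} {m₀ : MeasurableSpace Ω} {P : Measure Ω}
  [IsProbabilityMeasure P]

/-- The conditional expectation on `x` of the indicator of `t ∈ y` is the projection on the trivial
σ-field, hence a constant `c`. Pairing with indicators of `r ∈ x` gives `P (r ∩ t) = c * P r`, and
`r = univ` identifies `c`. -/
theorem indep_of_commute (hx : x ∈ subSigmaFields P) (hy : y ∈ subSigmaFields P)
    (h : Commute (condProj P x) (condProj P y)) (hxy : x ⊓ y = trivialSigmaField P) :
    Indep x y P := by
  rw [Indep_iff]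
  intro s t hs ht
  have h1 := condProj_inf_of_commute hx hy h (indL2 P t)
  rw [condProj_of_mem (indL2_mem hy.1 ht), hxy] at h1
  obtain ⟨c, hc⟩ := Submodule.mem_span_singleton.1
    (measL2_trivialSigmaField (condProj_mem (P := P) (x := trivialSigmaField P) (indL2 P t)))
  have hs' := hx.1 s hs
  have ht' := hy.1 t ht
  have key : ∀ r, MeasurableSet[x] r → P.real (r ∩ t) = c * P.real r := by
    intro r hr
    have hr' := hx.1 r hr
    rw [← inner_indL2 hr' ht']
    have e := Submodule.inner_starProjection_left_eq_right (measL2 P x) (indL2 P r) (indL2 P t)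
    change inner ℝ (condProj P x _) _ = inner ℝ _ (condProj P x _) at e
    rw [condProj_of_mem (indL2_mem hx.1 hr)] at e
    rw [e, ← h1, ← hc, inner_smul_right, inner_indL2 hr' .univ, Set.inter_univ]
  have hc1 := key Set.univ MeasurableSet.univ
  rw [Set.univ_inter, probReal_univ, mul_one] at hc1
  have h2 := key s hs
  rw [← hc1] at h2
  rw [← ENNReal.toReal_eq_toReal_iff' (measure_ne_top _ _)
    (ENNReal.mul_ne_top (measure_ne_top _ _) (measure_ne_top _ _)), ENNReal.toReal_mul]
  change P.real _ = P.real _ * P.real _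
  rw [h2, mul_comm]

/-- Information independent of `y` does not improve the prediction of a `y`-measurable function. -/
theorem condProj_sup_of_indep (hy : y ≤ m₀) (hv : v ≤ m₀) (hyv : Indep y v P) (hu : u ≤ y)
    {f : Lp ℝ 2 P} (hf : f ∈ measL2 P y) : condProj P (u ⊔ v) f = condProj P u f := by
  have hum := hu.trans hy
  refine (Submodule.eq_starProjection_of_mem_of_inner_eq_zero
    (measL2_mono (sup_le hum hv) le_sup_left (condProj_mem f)) ?_)
  set g := f - condProj P u f with hg
  have hgy : g ∈ measL2 P y := Submodule.sub_mem _ hf (measL2_mono hy hu (condProj_mem f))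
  intro w hw
  suffices hle : measL2 P (u ⊔ v) ≤ (Submodule.span ℝ {g})ᗮ from
    Submodule.mem_orthogonal_singleton_iff_inner_right.1 (hle hw)
  refine measL2_sup_le hum hv (Submodule.isClosed_orthogonal _) fun s t hs ht => ?_
  rw [Submodule.mem_orthogonal_singleton_iff_inner_right]
  have hs' := hum s hs
  have ht' := hv t ht
  -- By independence, against `y`-measurable functions the indicator of `s ∩ t` acts as `P t` times
  -- that of `s`.
  have h2 : measL2 P y ≤ (Submodule.span ℝ {indL2 P (s ∩ t) - P.real t • indL2 P s})ᗮ := by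
    refine measL2_le_of_forall_measurableSet hy (Submodule.isClosed_orthogonal _) fun r hr => ?_
    have hr' := hy r hr
    rw [Submodule.mem_orthogonal_singleton_iff_inner_right, inner_sub_left, inner_smul_left,
      inner_indL2 (hs'.inter ht') hr', inner_indL2 hs' hr', Set.inter_right_comm]
    have := Indep_iff y v P |>.1 hyv (s ∩ r) t ((hu s hs).inter hr) ht
    simp only [Measure.real, this, ENNReal.toReal_mul]
    simp [mul_comm]
  have h3 := Submodule.mem_orthogonal_singleton_iff_inner_right.1 (h2 hgy)
  have h4 : inner ℝ g (indL2 P s) = 0 :=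
    Submodule.starProjection_inner_eq_zero (K := measL2 P u) f _ (indL2_mem hum hs)
  rw [inner_sub_left, inner_smul_left, real_inner_comm _ (indL2 P s)] at h3
  rw [real_inner_comm]
  simpa [h4, real_inner_comm] using h3

theorem sup_inf_eq_of_indep (hy : y ≤ m₀) (hz : z ≤ m₀) (hyz : Indep y z P) (hu : u ≤ z)
    (hu' : u ∈ subSigmaFields P) : (y ⊔ u) ⊓ z = u := by
  refine le_antisymm (le_of_measL2_le (inf_le_right.trans hz) hu' fun f hf => ?_)
    (le_inf le_sup_right hu)
  have h1 := condProj_sup_of_indep hz hy hyz.symm hu (measL2_mono hz inf_le_right hf)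
  rw [sup_comm, condProj_of_mem (measL2_mono (sup_le hy (hu.trans hz)) inf_le_left hf)] at h1
  rw [h1]
  exact condProj_mem f

/-- It suffices that conditioning on `y` preserves `measL2 P x`, which is checked on the generators
`s ∩ t` with `s ∈ x ⊓ y`, `t ∈ x ⊓ z`: the factor `s` pulls out and `t` averages to a constant. -/
theorem commute_of_eq_sup (hx : x ≤ m₀) (hy : y ≤ m₀) (hz : z ≤ m₀)
    (hyz : Indep y z P) (h : x = (x ⊓ y) ⊔ (x ⊓ z)) :
    Commute (condProj P y) (condProj P x) := by
  refine Submodule.commute_starProjection_of_mapsTo _ _ ?_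
  suffices hle : measL2 P x ≤ (measL2 P x).comap (condProj P y).toLinearMap from
    fun f hf => hle hf
  nth_rewrite 1 [h]
  refine measL2_sup_le (inf_le_left.trans hx) (inf_le_left.trans hx)
    (isClosed_measL2.preimage (condProj P y).continuous) fun s t hs ht => ?_
  have htz := (inf_le_right : x ⊓ z ≤ z) t ht
  rw [Set.inter_comm]
  refine condProj_inter_mem hx hy (hz t htz) ((inf_le_right : x ⊓ y ≤ y) s hs)
    ((inf_le_left : x ⊓ y ≤ x) s hs) ?_
  -- With `u = ⊥`, conditioning on the independent `y` reduces to projecting onto constants.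
  have h1 := condProj_sup_of_indep (u := ⊥) hz hy hyz.symm bot_le (indL2_mem hz htz)
  rw [bot_sup_eq] at h1
  rw [h1]
  exact measL2_mono hx bot_le (condProj_mem _)

/-- Let `W` be the left side. For `s ∈ y`, projecting the indicator of `s` on `W` is the limit of
projecting on `u n ⊔ v`, where `v` is irrelevant, so it equals projecting on `⨅ n, u n`. A factor `t
∈ v` pulls out, and such `s ∩ t` generate `y ⊔ v ≥ W`. -/
theorem iInf_sup_of_indep {u : ℕ → MeasurableSpace Ω} (hu : ∀ n, u n ∈ subSigmaFields P)
    (hanti : Antitone u) (hy : y ≤ m₀) (hv : v ≤ m₀) (hyv : Indep y v P) (huy : ∀ n, u n ≤ y) :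
    ⨅ n, (u n ⊔ v) = (⨅ n, u n) ⊔ v := by
  have hI := iInf_mem_subSigmaFields hu
  have huv : ∀ n, u n ⊔ v ∈ subSigmaFields P := fun n =>
    mem_subSigmaFields_of_le (hu n) (sup_le (hu n).1 hv) le_sup_left
  have hW := iInf_mem_subSigmaFields huv
  have hIv := mem_subSigmaFields_of_le hI (sup_le hI.1 hv) le_sup_left
  refine le_antisymm (le_of_measL2_le hW.1 hIv ?_)
    (le_iInf fun n => sup_le_sup_right (iInf_le u n) v)
  have hle : measL2 P (y ⊔ v) ≤
      (measL2 P ((⨅ n, u n) ⊔ v)).comap (condProj P (⨅ n, (u n ⊔ v))).toLinearMap := by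
    refine measL2_sup_le hy hv
      (isClosed_measL2.preimage (ContinuousLinearMap.continuous _)) fun s t hs ht => ?_
    refine condProj_inter_mem hIv.1 hW.1 (hy s hs)
      ((le_iInf fun n => le_sup_right : v ≤ ⨅ n, (u n ⊔ v)) t ht)
      ((le_sup_right : v ≤ (⨅ n, u n) ⊔ v) t ht) ?_
    have h1 := tendsto_condProj_iInf huv (fun i j hij => sup_le_sup_right (hanti hij) v)
      (indL2 P s)
    have h2 := tendsto_condProj_iInf hu hanti (indL2 P s)
    have h3 : ∀ n, condProj P (u n ⊔ v) (indL2 P s) = condProj P (u n) (indL2 P s) :=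
      fun n => condProj_sup_of_indep hy hv hyv (huy n) (indL2_mem hy hs)
    simp only [h3] at h1
    rw [tendsto_nhds_unique h1 h2]
    exact measL2_mono hIv.1 le_sup_left (condProj_mem _)
  intro f hf
  have h1 := hle (measL2_mono (sup_le hy hv)
    ((iInf_le _ 0).trans (sup_le_sup_right (huy 0) v)) hf)
  rw [Submodule.mem_comap] at h1
  change condProj P _ f ∈ _ at h1
  rwa [condProj_of_mem hf] at h1

theorem iInf_sup_iInf_of_indep {u v : ℕ → MeasurableSpace Ω}
    (hu : ∀ n, u n ∈ subSigmaFields P) (hv : ∀ n, v n ∈ subSigmaFields P)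
    (hua : Antitone u) (hva : Antitone v) (hy : y ≤ m₀) (hz : z ≤ m₀) (hyz : Indep y z P)
    (huy : ∀ n, u n ≤ y) (hvz : ∀ n, v n ≤ z) :
    ⨅ n, (u n ⊔ v n) = (⨅ n, u n) ⊔ ⨅ n, v n := by
  refine le_antisymm ?_ (le_iInf fun n => sup_le_sup (iInf_le u n) (iInf_le v n))
  have h1 := iInf_sup_of_indep hv hva hz ((iInf_le u 0).trans (hu 0).1)
    (indep_of_indep_of_le_right hyz.symm ((iInf_le u 0).trans (huy 0))) hvz
  rw [sup_comm, ← h1]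
  refine le_iInf fun k => ?_
  rw [sup_comm, ← iInf_sup_of_indep hu hua hy (hv k).1
    (indep_of_indep_of_le_right hyz (hvz k)) huy]
  -- The double infimum over `n` and `k` is dominated by the diagonal.
  refine le_iInf fun n => (iInf_le _ (max n k)).trans ?_
  exact sup_le_sup (hua (le_max_left n k)) (hva (le_max_right n k))

end Independence

/-! ### The monotone closure and its complemented elements. -/

section Completion

variable {Ω : Type*} {x y z : MeasurableSpace Ω} {m₀ : MeasurableSpace Ω} {P : Measure Ω}
  {B : Set (MeasurableSpace Ω)}

/-- The least monotonically closed subset of `Λ` that contains `B`. -/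
def monotoneClosure (P : Measure Ω) (B : Set (MeasurableSpace Ω)) : Set (MeasurableSpace Ω) :=
  {x | ∀ Z ⊆ subSigmaFields P, MonotonicallyClosed Z → B ⊆ Z → x ∈ Z}

theorem monotonicallyClosed_subSigmaFields : MonotonicallyClosed (subSigmaFields P) :=
  ⟨fun _ hu _ => iInf_mem_subSigmaFields hu, fun _ hu _ => iSup_mem_subSigmaFields hu⟩

theorem subset_monotoneClosure : B ⊆ monotoneClosure P B := fun _ hx _ _ _ hB => hB hx

theorem monotoneClosure_subset (hB : B ⊆ subSigmaFields P) :
    monotoneClosure P B ⊆ subSigmaFields P :=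
  fun _ hx => hx _ subset_rfl monotonicallyClosed_subSigmaFields hB

theorem monotonicallyClosed_monotoneClosure : MonotonicallyClosed (monotoneClosure P B) :=
  ⟨fun u hu ha Z hZ hZc hBZ => hZc.1 u (fun n => hu n Z hZ hZc hBZ) ha,
    fun u hu hm Z hZ hZc hBZ => hZc.2 u (fun n => hu n Z hZ hZc hBZ) hm⟩

theorem monotoneClosure_induction (hB : B ⊆ subSigmaFields P) {p : MeasurableSpace Ω → Prop}
    (mem : ∀ x ∈ B, p x)
    (iInf : ∀ u : ℕ → MeasurableSpace Ω, (∀ n, u n ∈ monotoneClosure P B) → (∀ n, p (u n)) →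
      Antitone u → p (⨅ n, u n))
    (iSup : ∀ u : ℕ → MeasurableSpace Ω, (∀ n, u n ∈ monotoneClosure P B) → (∀ n, p (u n)) →
      Monotone u → p (⨆ n, u n)) (hx : x ∈ monotoneClosure P B) : p x := by
  refine (hx {x | x ∈ monotoneClosure P B ∧ p x} (fun x h => monotoneClosure_subset hB h.1)
    ⟨fun u hu ha => ?_, fun u hu hm => ?_⟩ fun x h => ⟨subset_monotoneClosure h, mem x h⟩).2
  · exact ⟨monotonicallyClosed_monotoneClosure.1 u (fun n => (hu n).1) ha,
      iInf u (fun n => (hu n).1) (fun n => (hu n).2) ha⟩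
  · exact ⟨monotonicallyClosed_monotoneClosure.2 u (fun n => (hu n).1) hm,
      iSup u (fun n => (hu n).1) (fun n => (hu n).2) hm⟩

/-- The elements of the monotone closure of `B` that have a complement in it. -/
def complementedClosure (P : Measure Ω) (B : Set (MeasurableSpace Ω)) : Set (MeasurableSpace Ω) :=
  {x | x ∈ monotoneClosure P B ∧
    ∃ y ∈ monotoneClosure P B, x ⊓ y = trivialSigmaField P ∧ x ⊔ y = m₀}

/-- Already `y ⊔ a` is everything, and by independence its trace on `x` is only `a`. -/
theorem eq_of_le_of_sup_eq [IsProbabilityMeasure P] {a b : MeasurableSpace Ω} (hx : x ≤ m₀)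
    (hy : y ≤ m₀) (hxy : Indep x y P) (ha : a ∈ subSigmaFields P) (hax : a ≤ x) (hby : b ≤ y)
    (hab : a ⊔ b = m₀) : a = x := by
  have h1 := sup_inf_eq_of_indep hy hx hxy.symm hax ha
  have h2 : y ⊔ a = m₀ := le_antisymm (sup_le hy ha.1) (by
    rw [← hab, sup_comm]; exact sup_le_sup_right hby a)
  rw [h2, inf_eq_right.2 hx] at h1
  exact h1.symm

namespace IsNoiseTypeBooleanAlgebra

variable (hB : IsNoiseTypeBooleanAlgebra P B)
include hB

theorem closure_subset : monotoneClosure P B ⊆ subSigmaFields P :=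
  monotoneClosure_subset hB.subset

theorem mem_complementedClosure (hx : x ∈ B) : x ∈ complementedClosure P B := by
  obtain ⟨y, hy, h⟩ := hB.exists_compl x hx
  exact ⟨subset_monotoneClosure hx, y, subset_monotoneClosure hy, h⟩

variable [IsProbabilityMeasure P]

theorem commute_of_mem (hx : x ∈ B) (hy : y ∈ B) : Commute (condProj P x) (condProj P y) := by
  obtain ⟨z, hz, h1, h2⟩ := hB.exists_compl x hx
  refine commute_of_eq_sup (hB.subset hy).1 (hB.subset hx).1 (hB.subset hz).1
    (hB.indep x hx z hz h1) ?_
  rw [← hB.distrib y hy x hx z hz, h2, inf_eq_left.2 (hB.subset hy).1]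

theorem commute_of_forall_commute
    (hy : ∀ x ∈ B, Commute (condProj P x) (condProj P y)) (hx : x ∈ monotoneClosure P B) :
    Commute (condProj P x) (condProj P y) := by
  refine monotoneClosure_induction (p := fun x => Commute (condProj P x) (condProj P y))
    hB.subset hy ?_ ?_ hx
  · intro u hu hc ha
    exact commute_of_tendsto (tendsto_condProj_iInf (fun n => hB.closure_subset (hu n)) ha) hc
  · intro u hu hc hm
    exact commute_of_tendsto (tendsto_condProj_iSup (fun n => hB.closure_subset (hu n)) hm) hc

/-- Two successive limit arguments, one per variable, starting from commutation on `B`. -/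
theorem commute_of_mem_closure (hx : x ∈ monotoneClosure P B) (hy : y ∈ monotoneClosure P B) :
    Commute (condProj P x) (condProj P y) :=
  hB.commute_of_forall_commute (fun _ hz =>
    (hB.commute_of_forall_commute (fun _ hw => hB.commute_of_mem hw hz) hy).symm) hx

theorem iSup_inf {u : ℕ → MeasurableSpace Ω} (hu : ∀ n, u n ∈ monotoneClosure P B)
    (hm : Monotone u) (hy : y ∈ monotoneClosure P B) : (⨆ n, u n) ⊓ y = ⨆ n, u n ⊓ y :=
  iSup_inf_of_commute (fun n => hB.closure_subset (hu n)) hm (hB.closure_subset hy)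
    fun n => hB.commute_of_mem_closure (hu n) hy

theorem inf_mem_closure_of_forall (hy : y ∈ monotoneClosure P B)
    (h : ∀ x ∈ B, x ⊓ y ∈ monotoneClosure P B) (hx : x ∈ monotoneClosure P B) :
    x ⊓ y ∈ monotoneClosure P B := by
  refine monotoneClosure_induction (p := fun x => x ⊓ y ∈ monotoneClosure P B)
    hB.subset h ?_ ?_ hx
  · intro u _ hc ha
    rw [iInf_inf]
    exact monotonicallyClosed_monotoneClosure.1 _ hc fun i j hij => inf_le_inf_right y (ha hij)
  · intro u hu hc hm
    rw [hB.iSup_inf hu hm hy]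
    exact monotonicallyClosed_monotoneClosure.2 _ hc fun i j hij => inf_le_inf_right y (hm hij)

theorem inf_mem_closure (hx : x ∈ monotoneClosure P B) (hy : y ∈ monotoneClosure P B) :
    x ⊓ y ∈ monotoneClosure P B := by
  refine hB.inf_mem_closure_of_forall hy (fun z hz => ?_) hx
  rw [inf_comm]
  refine hB.inf_mem_closure_of_forall (subset_monotoneClosure hz) (fun w hw => ?_) hy
  exact subset_monotoneClosure (hB.inf_mem w hw z hz)

theorem indep_of_mem_closure (hx : x ∈ monotoneClosure P B) (hy : y ∈ monotoneClosure P B)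
    (hxy : x ⊓ y = trivialSigmaField P) : Indep x y P :=
  indep_of_commute (hB.closure_subset hx) (hB.closure_subset hy)
    (hB.commute_of_mem_closure hx hy) hxy

theorem eq_sup_of_forall (hy : y ∈ monotoneClosure P B) (hz : z ∈ monotoneClosure P B)
    (hyz : y ⊓ z = trivialSigmaField P) (h : ∀ x ∈ B, x = (x ⊓ y) ⊔ (x ⊓ z))
    (hx : x ∈ monotoneClosure P B) : x = (x ⊓ y) ⊔ (x ⊓ z) := by
  refine monotoneClosure_induction (p := fun x => x = (x ⊓ y) ⊔ (x ⊓ z)) hB.subset h ?_ ?_ hx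
  · intro u hu hc ha
    have e := iInf_sup_iInf_of_indep (u := fun n => u n ⊓ y) (v := fun n => u n ⊓ z)
      (fun n => hB.closure_subset (hB.inf_mem_closure (hu n) hy))
      (fun n => hB.closure_subset (hB.inf_mem_closure (hu n) hz))
      (fun i j hij => inf_le_inf_right y (ha hij)) (fun i j hij => inf_le_inf_right z (ha hij))
      (hB.closure_subset hy).1 (hB.closure_subset hz).1 (hB.indep_of_mem_closure hy hz hyz)
      (fun _ => inf_le_right) (fun _ => inf_le_right)
    rw [iInf_inf, iInf_inf, ← e]
    exact iInf_congr hc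
  · intro u hu hc hm
    rw [hB.iSup_inf hu hm hy, hB.iSup_inf hu hm hz, ← iSup_sup_eq]
    exact iSup_congr hc

theorem eq_sup (hx : x ∈ monotoneClosure P B) (hy : y ∈ monotoneClosure P B)
    (hz : z ∈ monotoneClosure P B) (hyz : y ⊓ z = trivialSigmaField P) (hyz' : y ⊔ z = m₀) :
    x = (x ⊓ y) ⊔ (x ⊓ z) := by
  refine hB.eq_sup_of_forall hy hz hyz (fun x hx => ?_) hx
  obtain ⟨w, hw, hxw, hxw'⟩ := hB.exists_compl x hx
  have hxc := subset_monotoneClosure (P := P) hx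
  have hwc := subset_monotoneClosure (P := P) hw
  -- The roles are exchanged first: closure elements are split along `x` and `w`, where
  -- distributivity in `B` starts the induction. Splitting `y` and `z` this way shows that the parts
  -- of `x` and of `w` together generate `m₀`, so the parts of `x` fill `x`.
  have key : ∀ v ∈ monotoneClosure P B, v = (v ⊓ x) ⊔ (v ⊓ w) := fun v hv => by
    refine hB.eq_sup_of_forall hxc hwc hxw (fun v hv => ?_) hv
    rw [← hB.distrib v hv x hx w hw, hxw', inf_eq_left.2 (hB.subset hv).1]
  refine (eq_of_le_of_sup_eq (b := (w ⊓ y) ⊔ (w ⊓ z)) (hB.subset hx).1 (hB.subset hw).1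
    (hB.indep x hx w hw hxw) ?_ (sup_le inf_le_left inf_le_left) (sup_le inf_le_left inf_le_left)
    ?_).symm
  · exact sup_mem_subSigmaFields (hB.closure_subset (hB.inf_mem_closure hxc hy))
      (hB.closure_subset (hB.inf_mem_closure hxc hz))
  · rw [sup_sup_sup_comm, inf_comm x y, inf_comm w y, inf_comm x z, inf_comm w z, ← key y hy,
      ← key z hz, hyz']

/-- Joining with a complemented element amounts to joining with a part of its complement. -/
theorem sup_eq_inf_sup (hx : x ∈ monotoneClosure P B) (hy : y ∈ monotoneClosure P B)
    (hz : z ∈ monotoneClosure P B) (hyz : y ⊓ z = trivialSigmaField P) (hyz' : y ⊔ z = m₀) :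
    x ⊔ y = (x ⊓ z) ⊔ y := by
  refine le_antisymm (sup_le ?_ le_sup_right) (sup_le_sup_right inf_le_left y)
  nth_rewrite 1 [hB.eq_sup hx hy hz hyz hyz']
  exact sup_le (inf_le_right.trans le_sup_right) le_sup_left

theorem sup_inf_compl (hx : x ∈ monotoneClosure P B) (hy : y ∈ monotoneClosure P B)
    (hz : z ∈ monotoneClosure P B) (hyz : y ⊓ z = trivialSigmaField P) (hyz' : y ⊔ z = m₀) :
    (x ⊔ y) ⊓ z = x ⊓ z := by
  rw [hB.sup_eq_inf_sup hx hy hz hyz hyz', sup_comm]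
  exact sup_inf_eq_of_indep (hB.closure_subset hy).1 (hB.closure_subset hz).1
    (hB.indep_of_mem_closure hy hz hyz) inf_le_right
    (hB.closure_subset (hB.inf_mem_closure hx hz))

/-- Along a decreasing sequence, `u n` is replaced by `u n ⊓ z`, which is independent of `y`, so
that the join passes through the infimum. -/
theorem sup_mem_closure_of_forall (hy : y ∈ monotoneClosure P B) (hz : z ∈ monotoneClosure P B)
    (hyz : y ⊓ z = trivialSigmaField P) (hyz' : y ⊔ z = m₀)
    (h : ∀ x ∈ B, x ⊔ y ∈ monotoneClosure P B) (hx : x ∈ monotoneClosure P B) :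
    x ⊔ y ∈ monotoneClosure P B := by
  refine monotoneClosure_induction (p := fun x => x ⊔ y ∈ monotoneClosure P B)
    hB.subset h ?_ ?_ hx
  · intro u hu hc ha
    have e := iInf_sup_of_indep (u := fun n => u n ⊓ z)
      (fun n => hB.closure_subset (hB.inf_mem_closure (hu n) hz))
      (fun i j hij => inf_le_inf_right z (ha hij))
      (hB.closure_subset hz).1 (hB.closure_subset hy).1
      (hB.indep_of_mem_closure hy hz hyz).symm (fun _ => inf_le_right)
    have hI := monotonicallyClosed_monotoneClosure.1 u hu ha
    rw [hB.sup_eq_inf_sup hI hy hz hyz hyz', iInf_inf, ← e]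
    simp_rw [← fun n => hB.sup_eq_inf_sup (hu n) hy hz hyz hyz']
    exact monotonicallyClosed_monotoneClosure.1 _ hc fun i j hij => sup_le_sup_right (ha hij) y
  · intro u hu hc hm
    rw [iSup_sup]
    exact monotonicallyClosed_monotoneClosure.2 _ hc fun i j hij => sup_le_sup_right (hm hij) y

theorem sup_mem_closure (hx : x ∈ monotoneClosure P B) (hy : y ∈ complementedClosure P B) :
    x ⊔ y ∈ monotoneClosure P B := by
  obtain ⟨hyc, z, hz, h1, h2⟩ := hy
  refine hB.sup_mem_closure_of_forall hyc hz h1 h2 (fun w hw => ?_) hx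
  obtain ⟨w', hw', h3, h4⟩ := hB.exists_compl w hw
  -- With `w ∈ B` fixed, it is now `y` that runs through the closure; `w` has its complement in `B`.
  rw [sup_comm]
  refine hB.sup_mem_closure_of_forall (subset_monotoneClosure hw) (subset_monotoneClosure hw')
    h3 h4 (fun v hv => ?_) hyc
  exact subset_monotoneClosure (hB.sup_mem v hv w hw)

/-- De Morgan's law for complements in the monotone closure. -/
theorem isCompl_sup {x' y' : MeasurableSpace Ω} (hx : x ∈ monotoneClosure P B)
    (hx' : x' ∈ monotoneClosure P B) (hy : y ∈ monotoneClosure P B)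
    (hy' : y' ∈ monotoneClosure P B)
    (hxx : x ⊓ x' = trivialSigmaField P) (hxx' : x ⊔ x' = m₀)
    (hyy : y ⊓ y' = trivialSigmaField P) (hyy' : y ⊔ y' = m₀) :
    (x ⊔ y) ⊓ (x' ⊓ y') = trivialSigmaField P ∧ (x ⊔ y) ⊔ (x' ⊓ y') = m₀ := by
  constructor
  · have hle := trivialSigmaField_le (hB.closure_subset hy')
    rw [inf_comm x' y', ← inf_assoc, hB.sup_inf_compl hx hy hy' hyy hyy', inf_right_comm, hxx,
      inf_eq_left.2 hle]
  · refine le_antisymm (sup_le (sup_le (hB.closure_subset hx).1 (hB.closure_subset hy).1)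
      (inf_le_left.trans (hB.closure_subset hx').1)) ?_
    rw [← hyy']
    refine sup_le (le_sup_right.trans le_sup_left) ?_
    refine (hB.eq_sup hy' hx hx' hxx hxx').le.trans (sup_le ?_ ?_)
    · exact inf_le_right.trans (le_sup_left.trans le_sup_left)
    · rw [inf_comm]
      exact le_sup_right

theorem isNoiseTypeBooleanAlgebra_complementedClosure :
    IsNoiseTypeBooleanAlgebra P (complementedClosure P B) where
  subset := fun x hx => hB.closure_subset hx.1
  trivial_mem := hB.mem_complementedClosure hB.trivial_mem
  whole_mem := hB.mem_complementedClosure hB.whole_mem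
  indep := fun x hx y hy h => hB.indep_of_mem_closure hx.1 hy.1 h
  exists_compl := by
    rintro x ⟨hx, y, hy, h1, h2⟩
    exact ⟨y, ⟨hy, x, hx, by rwa [inf_comm], by rwa [sup_comm]⟩, h1, h2⟩
  sup_mem := by
    rintro x ⟨hx, x', hx', h1, h2⟩ y ⟨hy, y', hy', h3, h4⟩
    exact ⟨hB.sup_mem_closure hx ⟨hy, y', hy', h3, h4⟩, x' ⊓ y', hB.inf_mem_closure hx' hy',
      hB.isCompl_sup hx hx' hy hy' h1 h2 h3 h4⟩
  inf_mem := by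
    rintro x ⟨hx, x', hx', h1, h2⟩ y ⟨hy, y', hy', h3, h4⟩
    -- De Morgan's law is applied to the complements, so that `x ⊓ y` appears as the complement of
    -- `x' ⊔ y'`.
    rw [inf_comm] at h1 h3
    rw [sup_comm] at h2 h4
    have h5 := hB.isCompl_sup hx' hx hy' hy h1 h2 h3 h4
    rw [inf_comm, sup_comm (x' ⊔ y')] at h5
    exact ⟨hB.inf_mem_closure hx hy, x' ⊔ y', hB.sup_mem_closure hx' ⟨hy', y, hy, h3, h4⟩, h5⟩
  distrib := by
    rintro x ⟨hx, -⟩ y hyC z ⟨hz, -⟩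
    obtain ⟨hy, y', hy', h1, h2⟩ := id hyC
    refine le_antisymm ?_ (sup_le (inf_le_inf_left x le_sup_left) (inf_le_inf_left x le_sup_right))
    have hzy : y ⊔ z ∈ monotoneClosure P B := by
      rw [sup_comm]; exact hB.sup_mem_closure hz hyC
    -- Split along `y` and `y'`: the first part lies below `x ⊓ y`, and inside `y'` the join `y ⊔ z`
    -- reduces to `z ⊓ y'`.
    rw [hB.eq_sup (hB.inf_mem_closure hx hzy) hy hy' h1 h2]
    refine sup_le_sup (inf_le_inf_right y inf_le_left) ?_
    rw [inf_assoc, sup_comm, hB.sup_inf_compl hz hy hy' h1 h2]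
    exact inf_le_inf_left x inf_le_left

theorem isNoiseTypeCompletion_complementedClosure :
    IsNoiseTypeCompletion P B (complementedClosure P B) := by
  refine ⟨⟨hB.isNoiseTypeBooleanAlgebra_complementedClosure,
    fun x hx => hB.mem_complementedClosure hx, fun Z hZ hZc hBZ x hx => hx.1 Z hZ hZc hBZ⟩, ?_⟩
  rintro D ⟨hD, -, hBD⟩ x hx
  have hDc : D ⊆ monotoneClosure P B := fun y hy Z hZ hZc hBZ => hBD Z hZ hZc hBZ hy
  obtain ⟨y, hy, h⟩ := hD.exists_compl x hx
  exact ⟨hDc hx, y, hDc hy, h⟩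

end IsNoiseTypeBooleanAlgebra

end Completion

theorem theorem1 {Ω : Type*} {m₀ : MeasurableSpace Ω} (P : Measure Ω) [IsProbabilityMeasure P]
    (B : Set (MeasurableSpace Ω)) (hB : IsNoiseTypeBooleanAlgebra P B) :
    ∃ C : Set (MeasurableSpace Ω), IsNoiseTypeCompletion P B C :=
  ⟨_, hB.isNoiseTypeCompletion_complementedClosure⟩
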